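/- Let $M$ be a smooth $n$-manifold, $\psi=(\psi_1,\dots,\psi_{n+2}):M\to S^{n+1}\subset E^{n+2}$ a smooth immersion into the unit round sphere, and $\nu$ a smooth unit normal field of $M$ in $S^{n+1}$. In local coordinates let $g_{ij}=\langle\partial_i\psi,\partial_j\psi\rangle$, $A_{ij}=\langle\nabla^{S^{n+1}}_{\partial_i}\partial_j\psi,\nu\rangle$, and let $A=(g^{jk}A_{ik})$ be the shape operator; let $\psi_{a,ij}$ be the second covariant derivative of $\psi_a$ with respect to $g$. Let $\mu_0$ be a real function on $M$ (for example a constant) and put $$\sigma_k^\infty=\sum_{j=0}^{k}\frac{\mu_0^j}{j!}\,\sigma_{k-j}(A)\quad(k\ge 0),\qquad \sigma_k^\infty=0\quad(k<0),\qquad T_k^\infty=\sum_{j=0}^{k}(-1)^j\sigma_{k-j}^\infty A^j,$$ where $\sigma_k(A)$ is the $k$-th elementary symmetric polynomial of the eigenvalues of $A$; indices of $T_k^\infty$ are raised with $g$. Let $r\ge 2$ be an integer, and for a real number $c$ let $(\mathrm{P}_c)$ be the condition that every component $\psi_a$, $1\le a\le n+2$, satisfies on $M$ $$\bigl((r-1)(T_r^\infty)^{ij}-(n-r+1)(T_{r-2}^\infty)^{ij}\bigr)\psi_{a,ij}=c\,\mu_0\,\sigma_{r-2}^\infty\,\nu_a-\Bigl((r-1)\bigl((n-r)\sigma_r^\infty+\mu_0\sigma_{r-1}^\infty\bigr)-(n-r+1)\bigl((n-r+2)\sigma_{r-2}^\infty+\mu_0\sigma_{r-3}^\infty\bigr)\Bigr)\psi_a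 .$$ Then: (i) $(r+1)\sigma_{r+1}^\infty-(n-r+1)\sigma_{r-1}^\infty-\mu_0(\sigma_r^\infty-\sigma_{r-2}^\infty)=0$ on $M$ if and only if $(\mathrm{P}_c)$ holds with $c=n-2r+2$; (ii) $(r+1)\sigma_{r+1}^\infty-(n-r+1)\sigma_{r-1}^\infty-\mu_0(\sigma_r^\infty+\sigma_{r-2}^\infty)=0$ on $M$ (for constant $\mu_0$, the Euler–Lagrange equation of $\int_M\sigma_r^\infty\,dV$) if and only if $(\mathrm{P}_c)$ holds with $c=n$. -/

import Mathlib

open scoped ContDiff Manifold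

noncomputable section

/-- The Euclidean space `E^m`. -/
abbrev Euc (m : ℕ) : Type := EuclideanSpace ℝ (Fin m)

/-! ### Weighted elementary symmetric functions and weighted Newton transformations -/

section Algebra

variable {n : ℕ}

/-- `σ_k(A)`: the `k`-th elementary symmetric polynomial of the eigenvalues of `A`, counted with
multiplicity. It is used for matrices of shape operators, all of whose eigenvalues are real. -/
def sigma (A : Matrix (Fin n) (Fin n) ℝ) (k : ℕ) : ℝ :=
  A.charpoly.roots.esymm k

/-- `σ_k^∞(μ₀, A) = ∑_{j=0}^k (μ₀^j / j!) σ_{k-j}(A)`, and `0` for a negative index `k`. -/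
def wsigma (μ₀ : ℝ) (A : Matrix (Fin n) (Fin n) ℝ) : ℤ → ℝ
  | Int.ofNat k => ∑ j ∈ Finset.range (k + 1), μ₀ ^ j / (j.factorial : ℝ) * sigma A (k - j)
  | Int.negSucc _ => 0

/-- `T_k^∞(μ₀, A) = ∑_{j=0}^k (-1)^j σ_{k-j}^∞(μ₀, A) A^j`. -/
def wnewton (μ₀ : ℝ) (A : Matrix (Fin n) (Fin n) ℝ) (k : ℕ) : Matrix (Fin n) (Fin n) ℝ :=
  ∑ j ∈ Finset.range (k + 1), ((-1 : ℝ) ^ j * wsigma μ₀ A ((k : ℤ) - (j : ℤ))) • A ^ j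

end Algebra

/-! ### Local geometry of a parametrized hypersurface `X` with unit normal `N` -/

section Local

variable {n : ℕ} {F : Type*} [NormedAddCommGroup F] [NormedSpace ℝ F]

/-- The partial derivative `∂f/∂x_i`. -/
def pd (i : Fin n) (f : Euc n → F) (u : Euc n) : F :=
  fderiv ℝ f u (EuclideanSpace.single i 1)

/-- The induced metric `g_ij = ⟨∂X/∂x_i, ∂X/∂x_j⟩`. -/
def metric (X : Euc n → Euc (n + 2)) (u : Euc n) : Matrix (Fin n) (Fin n) ℝ :=
  Matrix.of fun i j => inner ℝ (pd i X u) (pd j X u)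

/-- The inverse metric `g^ij`. -/
def metricInv (X : Euc n → Euc (n + 2)) (u : Euc n) : Matrix (Fin n) (Fin n) ℝ :=
  (metric X u)⁻¹

/-- The Christoffel symbols `Γ^k_ij` of the Levi-Civita connection of the induced metric. -/
def christoffel (X : Euc n → Euc (n + 2)) (u : Euc n) (k i j : Fin n) : ℝ :=
  (1 / 2 : ℝ) * ∑ l, metricInv X u k l *
    (pd i (fun v => metric X v j l) u + pd j (fun v => metric X v i l) u
      - pd l (fun v => metric X v i j) u)

/-- The second covariant derivative `f_{,ij} = ∂²f/∂x_i∂x_j - Γ^k_ij ∂f/∂x_k` for the induced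
metric. -/
def covHess (X : Euc n → Euc (n + 2)) (f : Euc n → ℝ) (u : Euc n) (i j : Fin n) : ℝ :=
  pd i (pd j f) u - ∑ k, christoffel X u k i j * pd k f u

/-- The covariant derivative of the unit sphere along `X`, in the direction `∂/∂x_i`: the component
of `∂V/∂x_i` tangent to the sphere at `X`. -/
def sphereCov (X : Euc n → Euc (n + 2)) (i : Fin n) (V : Euc n → Euc (n + 2)) (u : Euc n) :
    Euc (n + 2) :=
  pd i V u - (inner ℝ (pd i V u) (X u) : ℝ) • X u

/-- The second fundamental form `A_ij = ⟨∇^S_{∂/∂x_i} ∂X/∂x_j, N⟩`. -/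
def secondFF (X N : Euc n → Euc (n + 2)) (u : Euc n) : Matrix (Fin n) (Fin n) ℝ :=
  Matrix.of fun i j => inner ℝ (sphereCov X i (pd j X) u) (N u)

/-- The shape operator: the entry in row `j` and column `i` is `A_i^j = g^{jk} A_{ik}`
(`A` is symmetric). -/
def shapeOp (X N : Euc n → Euc (n + 2)) (u : Euc n) : Matrix (Fin n) (Fin n) ℝ :=
  metricInv X u * secondFF X N u

/-- The Newton tensor `(T_k^∞)^{ij} = (T_k^∞)^i_l g^{lj}`. -/
def newtonUp (μ₀ : ℝ) (X N : Euc n → Euc (n + 2)) (u : Euc n) (k : ℕ) :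
    Matrix (Fin n) (Fin n) ℝ :=
  wnewton μ₀ (shapeOp X N u) k * metricInv X u

end Local

/-! ### Hypersurfaces of the unit sphere -/

section Hypersurface

variable {n : ℕ} {M : Type*} [TopologicalSpace M] [ChartedSpace (Euc n) M]

/-- `ψ` is a smooth immersion of the `n`-manifold `M` into the unit sphere `S^{n+1} ⊂ E^{n+2}` and
`ν` is a smooth unit normal field of it, tangent to the sphere. -/
structure IsSphereHypersurface (ψ ν : M → Euc (n + 2)) : Prop where
  smooth : ContMDiff (𝓡 n) 𝓘(ℝ, Euc (n + 2)) ∞ ψ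
  mem_sphere : ∀ x, ‖ψ x‖ = 1
  immersion : ∀ x, Function.Injective (mfderiv (𝓡 n) 𝓘(ℝ, Euc (n + 2)) ψ x)
  normal_smooth : ContMDiff (𝓡 n) 𝓘(ℝ, Euc (n + 2)) ∞ ν
  normal_unit : ∀ x, ‖ν x‖ = 1
  normal_position : ∀ x, inner ℝ (ψ x) (ν x) = 0
  normal_tangent : ∀ (x : M) (v : TangentSpace (𝓡 n) x),
    inner ℝ (E := Euc (n + 2)) (mfderiv (𝓡 n) 𝓘(ℝ, Euc (n + 2)) ψ x v) (ν x) = 0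

/-- The shape operator of `(ψ, ν)` at `x`, as a matrix in the coordinates given by the chart `φ`. -/
def shapeAt (ψ ν : M → Euc (n + 2)) (φ : OpenPartialHomeomorph M (Euc n)) (x : M) :
    Matrix (Fin n) (Fin n) ℝ :=
  shapeOp (ψ ∘ φ.symm) (ν ∘ φ.symm) (φ x)

/-- `σ_k^∞` of the hypersurface at `x`, computed in the chart `φ`. -/
def sigmaAt (μ₀ : M → ℝ) (ψ ν : M → Euc (n + 2)) (φ : OpenPartialHomeomorph M (Euc n)) (x : M)
    (k : ℤ) : ℝ :=
  wsigma (μ₀ x) (shapeAt ψ ν φ x) k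

/-- The equation `(r+1) σ_{r+1}^∞ - (n-r+1) σ_{r-1}^∞ - μ₀ (σ_r^∞ + ε σ_{r-2}^∞) = 0` holds
identically on `M`. -/
def MinimalEq (ε : ℝ) (μ₀ : M → ℝ) (ψ ν : M → Euc (n + 2)) (r : ℕ) : Prop :=
  ∀ φ ∈ IsManifold.maximalAtlas (𝓡 n) ∞ M, ∀ x ∈ φ.source,
    ((r : ℝ) + 1) * sigmaAt μ₀ ψ ν φ x ((r : ℤ) + 1)
      - ((n : ℝ) - r + 1) * sigmaAt μ₀ ψ ν φ x ((r : ℤ) - 1)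
      - μ₀ x * (sigmaAt μ₀ ψ ν φ x r + ε * sigmaAt μ₀ ψ ν φ x ((r : ℤ) - 2)) = 0

/-- Each component `ψ_a` of the position vector satisfies, in all local coordinates,
`((r-1) T_r^∞ - (n-r+1) T_{r-2}^∞)^{ij} ψ_{a,ij} = c μ₀ σ_{r-2}^∞ ν_a
  - ((r-1)((n-r) σ_r^∞ + μ₀ σ_{r-1}^∞) - (n-r+1)((n-r+2) σ_{r-2}^∞ + μ₀ σ_{r-3}^∞)) ψ_a`. -/
def PositionPDE (c : ℝ) (μ₀ : M → ℝ) (ψ ν : M → Euc (n + 2)) (r : ℕ) : Prop :=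
  ∀ a : Fin (n + 2), ∀ φ ∈ IsManifold.maximalAtlas (𝓡 n) ∞ M, ∀ x ∈ φ.source,
    ∑ i, ∑ j,
      (((r : ℝ) - 1) * newtonUp (μ₀ x) (ψ ∘ φ.symm) (ν ∘ φ.symm) (φ x) r i j
        - ((n : ℝ) - r + 1) * newtonUp (μ₀ x) (ψ ∘ φ.symm) (ν ∘ φ.symm) (φ x) (r - 2) i j)
        * covHess (ψ ∘ φ.symm) (fun u => ψ (φ.symm u) a) (φ x) i j
    = c * μ₀ x * sigmaAt μ₀ ψ ν φ x ((r : ℤ) - 2) * ν x a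
      - (((r : ℝ) - 1) * (((n : ℝ) - r) * sigmaAt μ₀ ψ ν φ x r
            + μ₀ x * sigmaAt μ₀ ψ ν φ x ((r : ℤ) - 1))
          - ((n : ℝ) - r + 1) * (((n : ℝ) - r + 2) * sigmaAt μ₀ ψ ν φ x ((r : ℤ) - 2)
            + μ₀ x * sigmaAt μ₀ ψ ν φ x ((r : ℤ) - 3))) * ψ x a

end Hypersurface

end

/-! ### Traces of the weighted Newton transformations -/

section NewtonTransformations

variable {n : ℕ}

/-! The Gauss formula for a hypersurface of the sphere reads ψ_{,ij} = A_ij ν - g_ij ψ. Contracting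
it with T_k^∞ gives tr(T_k^∞ A) ν - tr(T_k^∞) ψ, and the two traces are (k+1)σ_{k+1}^∞ - μ₀σ_k^∞ and
(n-k)σ_k^∞ + μ₀σ_{k-1}^∞. In the combination of k = r and k = r-2 the ψ-terms of the equation
cancel. With c = n-r+1+ε(r-1), what remains is (r-1)E_ε ν_a, where E_ε is the left side of the
scalar equation. As r ≥ 2 and ν ≠ 0, this vanishes for every a exactly when E_ε = 0; ε = -1 and ε =
1 give (i) and (ii). No derivative of μ₀ enters.

The first trace comes from Newton's identities through generating series
(`IsEigenvalueList.trace_wnewton_mul_self`), the second from the recursion `wnewton_succ`; the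
geometry is in `gauss_formula`. -/

theorem Matrix.trace_mul_pow_comm (P Q : Matrix (Fin n) (Fin n) ℝ) (k : ℕ) :
    ((P * Q) ^ k).trace = ((Q * P) ^ k).trace := by
  cases k with
  | zero => simp
  | succ k =>
    have h : ∀ k : ℕ, (P * Q) ^ (k + 1) = P * ((Q * P) ^ k * Q) := by
      intro k
      induction k with
      | zero => simp
      | succ k ih => rw [pow_succ', ih, pow_succ' (Q * P)]; simp only [mul_assoc]
    rw [h, Matrix.trace_mul_comm, mul_assoc, ← pow_succ]

theorem Matrix.IsHermitian.trace_pow_eq_sum_eigenvalues {A : Matrix (Fin n) (Fin n) ℝ}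
    (hA : A.IsHermitian) (k : ℕ) : (A ^ k).trace = ∑ i, hA.eigenvalues i ^ k := by
  conv_lhs => rw [hA.spectral_theorem, ← map_pow, Unitary.conjStarAlgAut_apply,
    Matrix.trace_mul_comm, ← mul_assoc]
  simp [Matrix.diagonal_pow, Matrix.trace_diagonal]

/-- `ev` lists the eigenvalues of `A` with multiplicity: its values are the roots of the
characteristic polynomial and its power sums are the traces of the powers of `A`. -/
structure IsEigenvalueList (A : Matrix (Fin n) (Fin n) ℝ) (ev : Fin n → ℝ) : Prop where
  roots : A.charpoly.roots = Finset.univ.val.map ev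
  trace_pow : ∀ k : ℕ, (A ^ k).trace = ∑ i, ev i ^ k

open scoped MatrixOrder Matrix.Norms.L2Operator in
-- A shape operator g⁻¹h need not be a symmetric matrix. Writing G = B*B, the product B*(BS) has the
-- same characteristic polynomial and the same traces of powers as the Hermitian matrix BSB*, so all
-- its eigenvalues are real.
theorem exists_isEigenvalueList_mul {G S : Matrix (Fin n) (Fin n) ℝ} (hG : G.PosSemidef)
    (hS : S.IsHermitian) : ∃ ev, IsEigenvalueList (G * S) ev := by
  obtain ⟨B, rfl⟩ := CStarAlgebra.nonneg_iff_eq_star_mul_self.mp hG.nonneg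
  rw [Matrix.star_eq_conjTranspose]
  have hH : (B * S * B.conjTranspose).IsHermitian :=
    Matrix.isHermitian_mul_mul_conjTranspose B hS
  refine ⟨hH.eigenvalues, ?_, fun k => ?_⟩
  · rw [mul_assoc, Matrix.charpoly_mul_comm, hH.roots_charpoly_eq_eigenvalues]
    rfl
  · rw [mul_assoc, Matrix.trace_mul_pow_comm, hH.trace_pow_eq_sum_eigenvalues]

namespace IsEigenvalueList

variable {A : Matrix (Fin n) (Fin n) ℝ} {ev : Fin n → ℝ}

/-- Newton's identities for the eigenvalues of `A`. -/
theorem succ_mul_sigma (h : IsEigenvalueList A ev) (k : ℕ) :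
    ((k : ℝ) + 1) * sigma A (k + 1) =
      ∑ p ∈ Finset.HasAntidiagonal.antidiagonal k, sigma A p.1 * ((-1) ^ p.2 * (A ^ (p.2 + 1)).trace) := by
  have hs : ∀ k, MvPolynomial.aeval ev (MvPolynomial.esymm (Fin n) ℝ k) = sigma A k := by
    intro k
    rw [MvPolynomial.aeval_esymm_eq_multiset_esymm, sigma, h.roots]
  have hp : ∀ k, MvPolynomial.aeval ev (MvPolynomial.psum (Fin n) ℝ k) = (A ^ k).trace := by
    intro k
    simp [MvPolynomial.psum, h.trace_pow]
  have key := congrArg (MvPolynomial.aeval ev) (MvPolynomial.mul_esymm_eq_sum (Fin n) ℝ (k + 1))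
  simp only [map_mul, map_sum, map_pow, map_neg, map_one, hs, hp, map_natCast] at key
  push_cast at key
  -- The filter removes only the pair (k+1, 0); the other pairs are those of sum k with second entry
  -- raised by one.
  rw [key, Finset.Nat.antidiagonal_succ', Finset.filter_cons_of_neg _ _ _ _ (by simp),
    Finset.filter_true_of_mem, Finset.sum_map, Finset.mul_sum]
  · refine Finset.sum_congr rfl fun p hp => ?_
    obtain rfl := Finset.HasAntidiagonal.mem_antidiagonal.1 hp
    have e : (-1 : ℝ) ^ (p.1 + p.2 + 1 + 1) * (-1) ^ p.1 = (-1) ^ p.2 := by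
      rw [← pow_add, show p.1 + p.2 + 1 + 1 + p.1 = 2 * (p.1 + 1) + p.2 by ring, pow_add, pow_mul]
      simp
    simp only [Function.Embedding.prodMap, Function.Embedding.coeFn_mk, Prod.map_fst, Prod.map_snd,
      Function.Embedding.refl_apply, Nat.succ_eq_add_one]
    rw [← e]
    ring
  · intro p hp
    simp only [Finset.mem_map, Finset.HasAntidiagonal.mem_antidiagonal] at hp
    obtain ⟨q, hq, rfl⟩ := hp
    simp
    omega

end IsEigenvalueList

/-- The generating series of the weighted elementary symmetric functions. -/
noncomputable def wsigmaSeries (μ₀ : ℝ) (A : Matrix (Fin n) (Fin n) ℝ) : PowerSeries ℝ :=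
  PowerSeries.mk fun k => wsigma μ₀ A k

theorem wsigmaSeries_eq_mul (μ₀ : ℝ) (A : Matrix (Fin n) (Fin n) ℝ) :
    wsigmaSeries μ₀ A = PowerSeries.mk (fun j => μ₀ ^ j / (j.factorial : ℝ)) *
      PowerSeries.mk (sigma A) := by
  ext k
  rw [PowerSeries.coeff_mul, Finset.Nat.sum_antidiagonal_eq_sum_range_succ_mk]
  simp [wsigmaSeries]
  rfl

theorem derivative_mk_pow_div_factorial (μ₀ : ℝ) :
    PowerSeries.derivative ℝ (PowerSeries.mk fun j => μ₀ ^ j / (j.factorial : ℝ)) =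
      PowerSeries.C μ₀ * PowerSeries.mk fun j => μ₀ ^ j / (j.factorial : ℝ) := by
  ext k
  rw [PowerSeries.coeff_derivative, PowerSeries.coeff_C_mul, PowerSeries.coeff_mk,
    PowerSeries.coeff_mk, Nat.factorial_succ]
  have := Nat.factorial_ne_zero k
  push_cast
  field_simp
  ring

theorem trace_wnewton_mul (μ₀ : ℝ) (A : Matrix (Fin n) (Fin n) ℝ) (k m : ℕ) :
    (wnewton μ₀ A k * A ^ m).trace = ∑ p ∈ Finset.HasAntidiagonal.antidiagonal k,
      wsigma μ₀ A p.1 * ((-1) ^ p.2 * (A ^ (p.2 + m)).trace) := by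
  rw [wnewton, Finset.sum_mul, Matrix.trace_sum,
    ← Finset.Nat.sum_antidiagonal_eq_sum_range_succ_mk
      (fun p : ℕ × ℕ => ((((-1 : ℝ) ^ p.1 * wsigma μ₀ A ((k : ℤ) - (p.1 : ℤ))) •
        A ^ p.1) * A ^ m).trace) k, ← Finset.Nat.sum_antidiagonal_swap]
  refine Finset.sum_congr rfl fun p hp => ?_
  obtain rfl := Finset.HasAntidiagonal.mem_antidiagonal.1 hp
  simp [← pow_add]
  ring

/-- With E = ∑ σ_k t^k, Newton's identities say E' = E Q. The weighted series is S = exp(μ₀t) E,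
hence S' = μ₀S + SQ. The coefficient of t^k in SQ is the trace sought. -/
theorem IsEigenvalueList.trace_wnewton_mul_self {A : Matrix (Fin n) (Fin n) ℝ} {ev : Fin n → ℝ}
    (h : IsEigenvalueList A ev) (μ₀ : ℝ) (k : ℕ) :
    (wnewton μ₀ A k * A).trace = ((k : ℝ) + 1) * wsigma μ₀ A (k + 1) - μ₀ * wsigma μ₀ A k := by
  set Q : PowerSeries ℝ := PowerSeries.mk fun j => (-1) ^ j * (A ^ (j + 1)).trace with hQ
  have hE : PowerSeries.derivative ℝ (PowerSeries.mk (sigma A)) = PowerSeries.mk (sigma A) * Q := by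
    ext k
    rw [PowerSeries.coeff_derivative, PowerSeries.coeff_mul, PowerSeries.coeff_mk, mul_comm,
      h.succ_mul_sigma]
    simp [hQ]
  have hP : PowerSeries.derivative ℝ (wsigmaSeries μ₀ A) =
      PowerSeries.C μ₀ * wsigmaSeries μ₀ A + wsigmaSeries μ₀ A * Q := by
    rw [wsigmaSeries_eq_mul, Derivation.leibniz, derivative_mk_pow_div_factorial, hE]
    simp only [smul_eq_mul]
    ring
  have hk := congrArg (PowerSeries.coeff k) hP
  rw [PowerSeries.coeff_derivative, map_add, PowerSeries.coeff_C_mul, PowerSeries.coeff_mul] at hk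
  have ht := trace_wnewton_mul μ₀ A k 1
  rw [pow_one] at ht
  simp only [wsigmaSeries, PowerSeries.coeff_mk, hQ] at hk
  rw [ht]
  push_cast at hk
  linarith

theorem wnewton_succ (μ₀ : ℝ) (A : Matrix (Fin n) (Fin n) ℝ) (k : ℕ) :
    wnewton μ₀ A (k + 1) = wsigma μ₀ A (k + 1) • 1 - wnewton μ₀ A k * A := by
  rw [wnewton, Finset.sum_range_succ', wnewton, Finset.sum_mul, add_comm, sub_eq_add_neg (_ • _),
    ← Finset.sum_neg_distrib]
  congr 1
  · simp
  · refine Finset.sum_congr rfl fun j _ => ?_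
    rw [smul_mul_assoc, ← pow_succ, ← neg_smul, pow_succ (-1 : ℝ)]
    push_cast
    congr 1
    rw [show (k : ℤ) + 1 - (j + 1) = k - j by ring]
    ring

theorem IsEigenvalueList.trace_wnewton {A : Matrix (Fin n) (Fin n) ℝ} {ev : Fin n → ℝ}
    (h : IsEigenvalueList A ev) (μ₀ : ℝ) (k : ℕ) :
    (wnewton μ₀ A k).trace =
      ((n : ℝ) - k) * wsigma μ₀ A k + μ₀ * wsigma μ₀ A ((k : ℤ) - 1) := by
  cases k with
  | zero =>
    -- The convention for negative indices makes the formula valid at k = 0.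
    have : wsigma μ₀ A (-1) = 0 := rfl
    simp [wnewton, this, mul_comm]
  | succ k =>
    rw [wnewton_succ, Matrix.trace_sub, h.trace_wnewton_mul_self]
    simp
    ring

end NewtonTransformations

open scoped Topology

/-! ### The Gauss formula in local coordinates -/

section LocalGeometry

variable {n : ℕ}

theorem ContDiffAt.pd {F : Type*} [NormedAddCommGroup F] [NormedSpace ℝ F] {f : Euc n → F}
    {u : Euc n} (hf : ContDiffAt ℝ ∞ f u) (i : Fin n) : ContDiffAt ℝ ∞ (pd i f) u :=
  (hf.fderiv_right (m := ∞) (by simp)).clm_apply contDiffAt_const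

theorem Filter.EventuallyEq.pd_eq {F : Type*} [NormedAddCommGroup F] [NormedSpace ℝ F]
    {f g : Euc n → F} {u : Euc n} (h : f =ᶠ[𝓝 u] g) (i : Fin n) : pd i f u = pd i g u := by
  rw [pd, pd, h.fderiv_eq]

theorem pd_const_apply {F : Type*} [NormedAddCommGroup F] [NormedSpace ℝ F] (c : F) (u : Euc n)
    (i : Fin n) : pd i (fun _ => c) u = 0 := by
  simp [pd]

theorem pd_inner_apply {m : ℕ} {f g : Euc n → Euc m} {u : Euc n} (hf : DifferentiableAt ℝ f u)
    (hg : DifferentiableAt ℝ g u) (i : Fin n) :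
    pd i (fun v => (inner ℝ (f v) (g v) : ℝ)) u
      = inner ℝ (f u) (pd i g u) + inner ℝ (pd i f u) (g u) :=
  fderiv_inner_apply ℝ hf hg _

theorem pd_component {m : ℕ} {f : Euc n → Euc m} {u : Euc n} (hf : DifferentiableAt ℝ f u)
    (i : Fin n) (a : Fin m) : pd i (fun v => f v a) u = pd i f u a := by
  have h : HasFDerivAt (fun v => f v a)
      ((EuclideanSpace.proj a : Euc m →L[ℝ] ℝ).comp (fderiv ℝ f u)) u :=
    (EuclideanSpace.proj a : Euc m →L[ℝ] ℝ).hasFDerivAt.comp u hf.hasFDerivAt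
  rw [pd, h.fderiv]
  rfl

theorem pd_pd_comm {F : Type*} [NormedAddCommGroup F] [NormedSpace ℝ F] {f : Euc n → F}
    {u : Euc n} (hf : ContDiffAt ℝ ∞ f u) (i j : Fin n) : pd i (pd j f) u = pd j (pd i f) u := by
  have hd : DifferentiableAt ℝ (fderiv ℝ f) u :=
    (hf.fderiv_right (m := ∞) (by simp)).differentiableAt (by simp)
  have h : ∀ i j : Fin n, pd i (pd j f) u =
      fderiv ℝ (fderiv ℝ f) u (EuclideanSpace.single i 1) (EuclideanSpace.single j 1) := by
    intro i j
    have := (hd.hasFDerivAt.clm_apply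
      (hasFDerivAt_const (EuclideanSpace.single j (1 : ℝ) : Euc n) u)).fderiv
    change fderiv ℝ (fun v => fderiv ℝ f v (EuclideanSpace.single j 1)) u _ = _
    rw [this]
    simp
  rw [h, h]
  exact (hf.isSymmSndFDerivAt (by simp; exact WithTop.coe_le_coe.2 le_top)) _ _

/-- `X` is, near `u`, a smooth immersion into the unit sphere, and `N u` is a unit vector normal
to the image of `X` and tangent to the sphere. -/
structure IsLocalSphereHypersurface (X N : Euc n → Euc (n + 2)) (u : Euc n) : Prop where
  smooth : ContDiffAt ℝ ∞ X u
  mem_sphere : ∀ᶠ v in 𝓝 u, ‖X v‖ = 1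
  immersion : LinearIndependent ℝ fun i => pd i X u
  normal_unit : ‖N u‖ = 1
  normal_position : inner ℝ (X u) (N u) = (0 : ℝ)
  normal_tangent : ∀ i, inner ℝ (pd i X u) (N u) = (0 : ℝ)

namespace IsLocalSphereHypersurface

variable {X N : Euc n → Euc (n + 2)} {u : Euc n}

theorem eventually_differentiableAt (h : IsLocalSphereHypersurface X N u) :
    ∀ᶠ v in 𝓝 u, DifferentiableAt ℝ X v :=
  ((h.smooth.of_le (m := 1) (by simp)).eventually (by simp)).mono
    fun _ hv => hv.differentiableAt (by simp)

theorem inner_pd_position_eventually (h : IsLocalSphereHypersurface X N u) (i : Fin n) :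
    ∀ᶠ v in 𝓝 u, inner ℝ (pd i X v) (X v) = (0 : ℝ) := by
  filter_upwards [h.mem_sphere.eventually_nhds, h.eventually_differentiableAt] with v hv hd
  have he : (fun w => (inner ℝ (X w) (X w) : ℝ)) =ᶠ[𝓝 v] fun _ => 1 := by
    filter_upwards [hv] with w hw
    rw [real_inner_self_eq_norm_sq, hw, one_pow]
  have := he.pd_eq i
  rw [pd_inner_apply hd hd, pd_const_apply, real_inner_comm] at this
  linarith

theorem differentiableAt_pd (h : IsLocalSphereHypersurface X N u) (i : Fin n) :
    DifferentiableAt ℝ (pd i X) u :=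
  (h.smooth.pd i).differentiableAt (by simp)

/-- Differentiate ⟨∂_j X, X⟩ = 0, which holds on a neighbourhood of the point. -/
theorem inner_pd_pd_position (h : IsLocalSphereHypersurface X N u) (i j : Fin n) :
    inner ℝ (pd i (pd j X) u) (X u) = -metric X u i j := by
  have := Filter.EventuallyEq.pd_eq (f := fun v => (inner ℝ (pd j X v) (X v) : ℝ))
    (g := fun _ => 0) (h.inner_pd_position_eventually j) i
  rw [pd_inner_apply (h.differentiableAt_pd j) (h.smooth.differentiableAt (by simp)),
    pd_const_apply, real_inner_comm] at this
  simp only [metric, Matrix.of_apply]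
  linarith

theorem secondFF_apply (h : IsLocalSphereHypersurface X N u) (i j : Fin n) :
    secondFF X N u i j = inner ℝ (pd i (pd j X) u) (N u) := by
  simp [secondFF, sphereCov, inner_sub_left, inner_smul_left, h.normal_position]

theorem secondFF_isHermitian (h : IsLocalSphereHypersurface X N u) :
    (secondFF X N u).IsHermitian := by
  ext i j
  rw [Matrix.conjTranspose_apply, h.secondFF_apply, h.secondFF_apply, pd_pd_comm h.smooth]
  rfl

theorem metric_posDef (h : IsLocalSphereHypersurface X N u) : (metric X u).PosDef :=
  Matrix.posDef_gram_of_linearIndependent h.immersion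

theorem isUnit_det_metric (h : IsLocalSphereHypersurface X N u) : IsUnit (metric X u).det :=
  h.metric_posDef.det_pos.ne'.isUnit

theorem metric_comm (X : Euc n → Euc (n + 2)) (u : Euc n) (i j : Fin n) :
    metric X u i j = metric X u j i :=
  real_inner_comm (pd j X u) (pd i X u)

theorem pd_metric (h : IsLocalSphereHypersurface X N u) (i j k : Fin n) :
    pd i (fun v => metric X v j k) u =
      inner ℝ (pd j X u) (pd i (pd k X) u) + inner ℝ (pd i (pd j X) u) (pd k X u) :=
  pd_inner_apply (h.differentiableAt_pd j) (h.differentiableAt_pd k) i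

/-- Expanding the derivatives of the metric by the product rule, four of the six terms cancel by
symmetry of second derivatives; the other two equal ⟨∂_i∂_j X, ∂_l X⟩. Lowering the index then
cancels g⁻¹. -/
theorem sum_christoffel_mul_metric (h : IsLocalSphereHypersurface X N u) (i j l : Fin n) :
    ∑ k, christoffel X u k i j * metric X u k l = inner ℝ (pd i (pd j X) u) (pd l X u) := by
  set w : Fin n → ℝ := fun l => inner ℝ (pd i (pd j X) u) (pd l X u)
  have hΓ : ∀ k, christoffel X u k i j = (metricInv X u).mulVec w k := by
    intro k
    rw [christoffel, Matrix.mulVec, dotProduct, Finset.mul_sum]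
    refine Finset.sum_congr rfl fun m _ => ?_
    rw [h.pd_metric, h.pd_metric, h.pd_metric, pd_pd_comm h.smooth j i, pd_pd_comm h.smooth m i,
      pd_pd_comm h.smooth m j, real_inner_comm (pd i (pd m X) u), real_inner_comm (pd j (pd m X) u),
      real_inner_comm (pd i X u)]
    simp only [w]
    ring
  calc ∑ k, christoffel X u k i j * metric X u k l
      = (metric X u).mulVec ((metricInv X u).mulVec w) l := by
        rw [Matrix.mulVec, dotProduct]
        exact Finset.sum_congr rfl fun k _ => by rw [hΓ, metric_comm X u l k, mul_comm]
    _ = w l := by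
        rw [metricInv, Matrix.mulVec_mulVec, Matrix.mul_nonsing_inv _ h.isUnit_det_metric,
          Matrix.one_mulVec]

theorem norm_position (h : IsLocalSphereHypersurface X N u) : ‖X u‖ = 1 :=
  h.mem_sphere.self_of_nhds

theorem inner_pd_position (h : IsLocalSphereHypersurface X N u) (i : Fin n) :
    inner ℝ (pd i X u) (X u) = (0 : ℝ) :=
  (h.inner_pd_position_eventually i).self_of_nhds

theorem inner_position_pd (h : IsLocalSphereHypersurface X N u) (i : Fin n) :
    inner ℝ (X u) (pd i X u) = (0 : ℝ) := by
  rw [real_inner_comm, h.inner_pd_position]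

theorem inner_normal_pd (h : IsLocalSphereHypersurface X N u) (i : Fin n) :
    inner ℝ (N u) (pd i X u) = (0 : ℝ) := by
  rw [real_inner_comm, h.normal_tangent]

theorem inner_normal_position (h : IsLocalSphereHypersurface X N u) :
    inner ℝ (N u) (X u) = (0 : ℝ) := by
  rw [real_inner_comm, h.normal_position]

/-- The tangent vectors, the position vector and the normal span `E^{n+2}`. -/
theorem eq_zero_of_inner_eq_zero (h : IsLocalSphereHypersurface X N u) {v : Euc (n + 2)}
    (hT : ∀ i, inner ℝ v (pd i X u) = (0 : ℝ)) (hX : inner ℝ v (X u) = (0 : ℝ))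
    (hN : inner ℝ v (N u) = (0 : ℝ)) : v = 0 := by
  let L : Euc (n + 2) →ₗ[ℝ] (Fin n → ℝ) × ℝ × ℝ :=
    (LinearMap.pi fun i => (innerₛₗ ℝ (pd i X u))).prod
      ((innerₛₗ ℝ (X u)).prod (innerₛₗ ℝ (N u)))
  have hsurj : Function.Surjective L := by
    rintro ⟨a, b, c⟩
    -- `X u` and `N u` are orthonormal and orthogonal to the tangent vectors, whose Gram matrix is
    -- g; so g⁻¹a gives the tangential coefficients.
    refine ⟨(∑ k, (metricInv X u).mulVec a k • pd k X u) + b • X u + c • N u, ?_⟩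
    have ha : (metric X u).mulVec ((metricInv X u).mulVec a) = a := by
      rw [metricInv, Matrix.mulVec_mulVec, Matrix.mul_nonsing_inv _ h.isUnit_det_metric,
        Matrix.one_mulVec]
    refine Prod.ext ?_ (Prod.ext ?_ ?_)
    · funext i
      conv_rhs => rw [← ha]
      simp [L, inner_add_right, inner_sum, inner_smul_right, h.inner_pd_position, h.normal_tangent,
        Matrix.mulVec, dotProduct, metric, mul_comm]
    · simp [L, inner_add_right, inner_sum, inner_smul_right, h.norm_position,
        h.normal_position, h.inner_position_pd]
    · simp [L, inner_add_right, inner_sum, inner_smul_right, h.normal_unit,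
        h.inner_normal_position, h.inner_normal_pd]
  -- Both spaces have dimension n + 2.
  have hinj : Function.Injective L :=
    (LinearMap.injective_iff_surjective_of_finrank_eq_finrank (by simp)).2 hsurj
  refine hinj ?_
  rw [map_zero]
  refine Prod.ext (funext fun i => ?_) (Prod.ext ?_ ?_)
  · simpa [L, real_inner_comm] using hT i
  · simpa [L, real_inner_comm] using hX
  · simpa [L, real_inner_comm] using hN

/-- The Gauss formula `X_{,ij} = A_ij N - g_ij X`. -/
theorem gauss_formula (h : IsLocalSphereHypersurface X N u) (i j : Fin n) :
    pd i (pd j X) u - ∑ k, christoffel X u k i j • pd k X u =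
      secondFF X N u i j • N u - metric X u i j • X u := by
  rw [← sub_eq_zero]
  refine h.eq_zero_of_inner_eq_zero (fun l => ?_) ?_ ?_
  · have := h.sum_christoffel_mul_metric i j l
    simp only [metric, Matrix.of_apply] at this
    simp [inner_sub_left, sum_inner, inner_smul_left, h.inner_normal_pd,
      h.inner_position_pd, this]
  · simp [inner_sub_left, sum_inner, inner_smul_left, h.inner_pd_pd_position,
      h.inner_normal_position, h.norm_position, h.inner_pd_position]
  · simp [inner_sub_left, sum_inner, inner_smul_left, h.secondFF_apply, h.normal_position,
      h.normal_unit, h.normal_tangent]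

theorem covHess_component (h : IsLocalSphereHypersurface X N u) (a : Fin (n + 2)) (i j : Fin n) :
    covHess X (fun v => X v a) u i j =
      secondFF X N u i j * N u a - metric X u i j * X u a := by
  have he : pd j (fun v => X v a) =ᶠ[𝓝 u] fun v => pd j X v a := by
    filter_upwards [h.eventually_differentiableAt] with v hv
    exact pd_component hv j a
  have hg := congrArg (fun v : Euc (n + 2) => v a) (h.gauss_formula i j)
  simp only [PiLp.sub_apply, PiLp.smul_apply, smul_eq_mul, WithLp.ofLp_sum, Finset.sum_apply] at hg
  rw [covHess, he.pd_eq, pd_component (h.differentiableAt_pd j), ← hg]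
  simp only [pd_component h.eventually_differentiableAt.self_of_nhds]

theorem exists_isEigenvalueList_shapeOp (h : IsLocalSphereHypersurface X N u) :
    ∃ ev, IsEigenvalueList (shapeOp X N u) ev :=
  exists_isEigenvalueList_mul h.metric_posDef.inv.posSemidef h.secondFF_isHermitian

theorem sum_newtonUp_mul_secondFF (h : IsLocalSphereHypersurface X N u) (μ₀ : ℝ) (k : ℕ) :
    ∑ i, ∑ j, newtonUp μ₀ X N u k i j * secondFF X N u i j =
      ((k : ℝ) + 1) * wsigma μ₀ (shapeOp X N u) (k + 1) - μ₀ * wsigma μ₀ (shapeOp X N u) k := by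
  obtain ⟨ev, hev⟩ := h.exists_isEigenvalueList_shapeOp
  rw [← hev.trace_wnewton_mul_self, shapeOp, ← mul_assoc, Matrix.trace]
  refine Finset.sum_congr rfl fun i _ => ?_
  rw [Matrix.diag_apply, Matrix.mul_apply]
  refine Finset.sum_congr rfl fun j _ => ?_
  -- The trace pairs T^{ij} with A_ji, so symmetry of A is needed.
  rw [← h.secondFF_isHermitian.apply i j]
  rfl

theorem sum_newtonUp_mul_metric (h : IsLocalSphereHypersurface X N u) (μ₀ : ℝ) (k : ℕ) :
    ∑ i, ∑ j, newtonUp μ₀ X N u k i j * metric X u i j =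
      ((n : ℝ) - k) * wsigma μ₀ (shapeOp X N u) k
        + μ₀ * wsigma μ₀ (shapeOp X N u) ((k : ℤ) - 1) := by
  obtain ⟨ev, hev⟩ := h.exists_isEigenvalueList_shapeOp
  have hT : wnewton μ₀ (shapeOp X N u) k = newtonUp μ₀ X N u k * metric X u := by
    rw [newtonUp, metricInv, mul_assoc, Matrix.nonsing_inv_mul _ h.isUnit_det_metric, mul_one]
  rw [← hev.trace_wnewton, hT, Matrix.trace]
  refine Finset.sum_congr rfl fun i _ => ?_
  rw [Matrix.diag_apply, Matrix.mul_apply]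
  exact Finset.sum_congr rfl fun j _ => by rw [metric_comm X u i j]

theorem sum_newtonUp_mul_covHess (h : IsLocalSphereHypersurface X N u) (μ₀ : ℝ) (k : ℕ)
    (a : Fin (n + 2)) :
    ∑ i, ∑ j, newtonUp μ₀ X N u k i j * covHess X (fun v => X v a) u i j =
      (((k : ℝ) + 1) * wsigma μ₀ (shapeOp X N u) (k + 1)
        - μ₀ * wsigma μ₀ (shapeOp X N u) k) * N u a
      - (((n : ℝ) - k) * wsigma μ₀ (shapeOp X N u) k
        + μ₀ * wsigma μ₀ (shapeOp X N u) ((k : ℤ) - 1)) * X u a := by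
  rw [← h.sum_newtonUp_mul_secondFF, ← h.sum_newtonUp_mul_metric]
  simp only [h.covHess_component, Finset.sum_mul, ← Finset.sum_sub_distrib]
  exact Finset.sum_congr rfl fun i _ => Finset.sum_congr rfl fun j _ => by ring

end IsLocalSphereHypersurface

end LocalGeometry

/-! ### From charts to the manifold -/

section Manifold

variable {n : ℕ} {M : Type*} [TopologicalSpace M] [ChartedSpace (Euc n) M]

theorem contMDiffAt_symm_of_mem_maximalAtlas_of_mem_source {φ : OpenPartialHomeomorph M (Euc n)}
    (hφ : φ ∈ IsManifold.maximalAtlas (𝓡 n) ∞ M) {x : M} (hx : x ∈ φ.source) :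
    ContMDiffAt (𝓡 n) (𝓡 n) ∞ φ.symm (φ x) :=
  (contMDiffOn_symm_of_mem_maximalAtlas hφ).contMDiffAt
    (φ.open_target.mem_nhds (φ.map_source hx))

theorem mfderiv_symm_injective {φ : OpenPartialHomeomorph M (Euc n)}
    (hφ : φ ∈ IsManifold.maximalAtlas (𝓡 n) ∞ M) {x : M} (hx : x ∈ φ.source) :
    Function.Injective (mfderiv (𝓡 n) (𝓡 n) φ.symm (φ x)) := by
  have hs : MDifferentiableAt (𝓡 n) (𝓡 n) φ.symm (φ x) :=
    (contMDiffAt_symm_of_mem_maximalAtlas_of_mem_source hφ hx).mdifferentiableAt (by simp)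
  have hf : MDifferentiableAt (𝓡 n) (𝓡 n) φ (φ.symm (φ x)) := by
    rw [φ.left_inv hx]
    exact ((contMDiffOn_of_mem_maximalAtlas hφ).contMDiffAt
      (φ.open_source.mem_nhds hx)).mdifferentiableAt (by simp)
  have hid : φ ∘ φ.symm =ᶠ[𝓝 (φ x)] id := by
    filter_upwards [φ.open_target.mem_nhds (φ.map_source hx)] with v hv
    exact φ.right_inv hv
  have hc := (mfderiv_comp (φ x) hf hs).symm.trans (hid.mfderiv_eq.trans mfderiv_id)
  intro v w hvw
  have hv := congrArg (fun T => T v) hc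
  have hw := congrArg (fun T => T w) hc
  have h1 := congrArg (mfderiv (𝓡 n) (𝓡 n) φ (φ.symm (φ x))) hvw
  exact hv.symm.trans (h1.trans hw)

/-- In the coordinates of a chart, a hypersurface of the sphere is a local hypersurface. -/
theorem IsSphereHypersurface.isLocalSphereHypersurface {ψ ν : M → Euc (n + 2)}
    (h : IsSphereHypersurface ψ ν) {φ : OpenPartialHomeomorph M (Euc n)}
    (hφ : φ ∈ IsManifold.maximalAtlas (𝓡 n) ∞ M) {x : M} (hx : x ∈ φ.source) :
    IsLocalSphereHypersurface (ψ ∘ φ.symm) (ν ∘ φ.symm) (φ x) := by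
  have hs := contMDiffAt_symm_of_mem_maximalAtlas_of_mem_source hφ hx
  have hψ : ContMDiffAt (𝓡 n) 𝓘(ℝ, Euc (n + 2)) ∞ (ψ ∘ φ.symm) (φ x) :=
    (h.smooth _).comp _ hs
  have hd : fderiv ℝ (ψ ∘ φ.symm) (φ x) =
      (mfderiv (𝓡 n) 𝓘(ℝ, Euc (n + 2)) ψ (φ.symm (φ x))).comp
        (mfderiv (𝓡 n) (𝓡 n) φ.symm (φ x)) := by
    rw [← mfderiv_eq_fderiv]
    exact mfderiv_comp (φ x) ((h.smooth _).mdifferentiableAt (by simp))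
      (hs.mdifferentiableAt (by simp))
  refine ⟨hψ.contDiffAt, .of_forall fun v => h.mem_sphere _, ?_, h.normal_unit _,
    h.normal_position _, fun i => ?_⟩
  · have hinj : Function.Injective (fderiv ℝ (ψ ∘ φ.symm) (φ x)) := by
      rw [hd]
      exact (h.immersion _).comp (mfderiv_symm_injective hφ hx)
    have hb := (EuclideanSpace.basisFun (Fin n) ℝ).toBasis.linearIndependent.map'
      (fderiv ℝ (ψ ∘ φ.symm) (φ x)).toLinearMap (LinearMap.ker_eq_bot.2 hinj)
    have he : (fun i => pd i (ψ ∘ φ.symm) (φ x)) =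
        (fderiv ℝ (ψ ∘ φ.symm) (φ x)).toLinearMap ∘
          (EuclideanSpace.basisFun (Fin n) ℝ).toBasis := by
      funext i
      simp [pd]
    rw [he]
    exact hb
  · rw [pd, hd]
    exact h.normal_tangent _ _

/-- At each point, the equation for the position vector is the equation for the weighted
elementary symmetric functions, up to the factor `r - 1`. -/
theorem IsSphereHypersurface.positionPDE_iff_minimalEq {ψ ν : M → Euc (n + 2)}
    (h : IsSphereHypersurface ψ ν) (μ₀ : M → ℝ) {r : ℕ} (hr : 2 ≤ r) {c ε : ℝ}
    (hc : c = (n : ℝ) - r + 1 + ε * ((r : ℝ) - 1)) :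
    MinimalEq ε μ₀ ψ ν r ↔ PositionPDE c μ₀ ψ ν r := by
  -- The two sides of the position equation differ by exactly (r-1)E_ε ν_a.
  have key : ∀ φ ∈ IsManifold.maximalAtlas (𝓡 n) ∞ M, ∀ x ∈ φ.source, ∀ a : Fin (n + 2),
      ∑ i, ∑ j,
        (((r : ℝ) - 1) * newtonUp (μ₀ x) (ψ ∘ φ.symm) (ν ∘ φ.symm) (φ x) r i j
          - ((n : ℝ) - r + 1) * newtonUp (μ₀ x) (ψ ∘ φ.symm) (ν ∘ φ.symm) (φ x) (r - 2) i j)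
          * covHess (ψ ∘ φ.symm) (fun u => ψ (φ.symm u) a) (φ x) i j
      = (c * μ₀ x * sigmaAt μ₀ ψ ν φ x ((r : ℤ) - 2) * ν x a
        - (((r : ℝ) - 1) * (((n : ℝ) - r) * sigmaAt μ₀ ψ ν φ x r
              + μ₀ x * sigmaAt μ₀ ψ ν φ x ((r : ℤ) - 1))
            - ((n : ℝ) - r + 1) * (((n : ℝ) - r + 2) * sigmaAt μ₀ ψ ν φ x ((r : ℤ) - 2)
              + μ₀ x * sigmaAt μ₀ ψ ν φ x ((r : ℤ) - 3))) * ψ x a)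
        + ((r : ℝ) - 1) * (((r : ℝ) + 1) * sigmaAt μ₀ ψ ν φ x ((r : ℤ) + 1)
          - ((n : ℝ) - r + 1) * sigmaAt μ₀ ψ ν φ x ((r : ℤ) - 1)
          - μ₀ x * (sigmaAt μ₀ ψ ν φ x r + ε * sigmaAt μ₀ ψ ν φ x ((r : ℤ) - 2))) * ν x a := by
    intro φ hφ x hx a
    have hl := h.isLocalSphereHypersurface hφ hx
    have hr0 := hl.sum_newtonUp_mul_covHess (μ₀ x) r a
    have hr2 := hl.sum_newtonUp_mul_covHess (μ₀ x) (r - 2) a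
    simp only [Function.comp_apply, φ.left_inv hx] at hr0 hr2
    push_cast [Nat.cast_sub hr] at hr2
    rw [show (r : ℤ) - 2 + 1 = r - 1 by ring, show (r : ℤ) - 2 - 1 = r - 3 by ring] at hr2
    simp only [sub_mul, Finset.sum_sub_distrib, mul_assoc, ← Finset.mul_sum]
    simp only [sub_mul, mul_assoc] at hr0 hr2
    rw [hr0, hr2, hc]
    simp only [sigmaAt, shapeAt]
    ring
  have hr1 : (r : ℝ) - 1 ≠ 0 := by
    have : (2 : ℝ) ≤ r := by exact_mod_cast hr
    linarith
  constructor
  · intro hm a φ hφ x hx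
    rw [key φ hφ x hx a, hm φ hφ x hx]
    ring
  · intro hp φ hφ x hx
    -- One component with ν_a ≠ 0 suffices to recover the scalar equation at `x`.
    obtain ⟨a, ha⟩ : ∃ a, ν x a ≠ 0 := by
      by_contra! h0
      have : ν x = 0 := by
        ext a
        exact h0 a
      simpa [this] using h.normal_unit x
    have := (key φ hφ x hx a).symm.trans (hp a φ hφ x hx)
    simpa [hr1, ha] using this

end Manifold

theorem mainTheorem5 {n : ℕ} {M : Type*} [TopologicalSpace M] [ChartedSpace (Euc n) M]
    [IsManifold (𝓡 n) ∞ M] (ψ ν : M → Euc (n + 2)) (hψ : IsSphereHypersurface ψ ν)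
    (μ₀ : M → ℝ) (r : ℕ) (hr : 2 ≤ r) :
    (MinimalEq (-1) μ₀ ψ ν r ↔ PositionPDE ((n : ℝ) - 2 * r + 2) μ₀ ψ ν r) ∧
    (MinimalEq 1 μ₀ ψ ν r ↔ PositionPDE (n : ℝ) μ₀ ψ ν r) :=
  ⟨hψ.positionPDE_iff_minimalEq μ₀ hr (by ring), hψ.positionPDE_iff_minimalEq μ₀ hr (by ring)⟩
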